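/- Let $0<\alpha\le 2$ and let $\mu$ be the probability measure on the real Hilbert space $\ell_2$ with characteristic function $$\widehat\mu(y)=\exp\Bigl\{-\tfrac12\sum_{i=1}^\infty |y_i|^\alpha\lambda_i\Bigr\},\qquad y\in\ell_2,$$ where $\lambda_1\ge\lambda_2\ge\dots\ge 0$ and $\sum_i\lambda_i<\infty$. Let $\sigma_\alpha:[1,\infty)\to(0,\infty)$ be a differentiable decreasing function with $\sigma_\alpha(n)\le\lambda_n^{1/\alpha}$ for $n=1,2,\dots$. Let $p_\alpha(x)=\frac1{2\pi}\int_{-\infty}^{\infty}\cos(tx)\,e^{-|t|^\alpha/2}\,dt$ be the density of the symmetric stable law on $\mathbb R$ with characteristic function $e^{-|t|^\alpha/2}$, and put $$\varphi(x)=\frac{2p_\alpha(0)}{\sigma_\alpha(x)},\qquad \Psi(x)=\frac{C_0(\alpha)}{\sigma_\alpha(x)\sqrt x},\qquad C_0(\alpha)=\frac{2^{1/2+1/\alpha}\,\Gamma(1/\alpha)}{\sqrt\pi\,\alpha},$$ $$H(y)=\int_1^y\frac{x\varphi'(x)}{\varphi(x)}\,dx,\qquad K(y)=\int_1^y\frac{x\Psi'(x)}{\Psi(x)}\,dx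 .$$ Let $\nu,\eta$ be functions with values in the positive integers such that $\varepsilon\,\varphi(\nu(\varepsilon))\le1$ for all $0<\varepsilon<\varphi(1)^{-1}$ and $\varepsilon\,\Psi(\eta(\varepsilon))\le 1$ for all $0<\varepsilon<\Psi(1)^{-1}$. Let $D_\varepsilon=\{x\in\ell_2:\sup_i|x_i|\le\varepsilon\}$ and $S_\varepsilon=\{x\in\ell_2:\|x\|\le\varepsilon\}$. Then there is a constant $C=C(\alpha,\lambda_1)>0$, depending only on $\alpha$ and $\lambda_1$, such that for all $0<\varepsilon<\bigl(\max(\varphi(1),\Psi(1))\bigr)^{-1}$ $$\mu(D_\varepsilon)\le C\exp\{-H(\nu(\varepsilon))-\log\varepsilon\},\qquad \mu(S_\varepsilon)\le C\exp\{-K(\eta(\varepsilon))-\log\varepsilon\},$$ and, if $\log\sigma_\alpha$ is convex on $[1,\infty)$, then moreover $$\mu(D_\varepsilon)\le C\exp\{-H(\nu(\varepsilon))-\tfrac12\log\varepsilon\},\qquad \mu(S_\varepsilon)\le C\exp\{-K(\eta(\varepsilon))-\tfrac14\log(\varepsilon^2\eta(\varepsilon))\}.$$ -/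

import Mathlib

open MeasureTheory

noncomputable section

namespace StableSmallBall

/-- The real Hilbert space `ℓ₂`. Coordinates are numbered from `0`: the Lean coordinate `x i` is the
`(i+1)`-st coordinate `x_{i+1}` of the usual notation. -/
abbrev EllTwo : Type := lp (fun _ : ℕ => ℝ) 2

/-- The sup-norm `‖x‖_∞ = sup_i |x_i|` on `ℓ₂` (the supremum is over a bounded set). -/
def supNorm (x : EllTwo) : ℝ := ⨆ i : ℕ, |x i|

/-- `D_ε = {x ∈ ℓ₂ : ‖x‖_∞ ≤ ε}`. -/
def supBall (ε : ℝ) : Set EllTwo := {x | supNorm x ≤ ε}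

/-- `S_ε = {x ∈ ℓ₂ : ‖x‖ ≤ ε}`. -/
def normBall (ε : ℝ) : Set EllTwo := {x | ‖x‖ ≤ ε}

/-- The continuous density `p_α` of the symmetric stable law on `ℝ` with characteristic function
`exp (-|t|^α / 2)`, given by the Fourier inversion formula
`p_α(x) = (2π)⁻¹ ∫ exp(-itx) exp(-|t|^α / 2) dt`; the imaginary part vanishes because the
characteristic function is even. -/
def stableDensity (α x : ℝ) : ℝ :=
  (2 * Real.pi)⁻¹ * ∫ t : ℝ, Real.cos (t * x) * Real.exp (-(|t| ^ α / 2))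

/-- `φ(x) = 2 p_α(0) / σ(x)`. -/
def phi (α : ℝ) (σ : ℝ → ℝ) (x : ℝ) : ℝ := 2 * stableDensity α 0 / σ x

/-- `C₀(α) = 2^{1/2 + 1/α} Γ(1/α) / (√π α)`. -/
def C₀ (α : ℝ) : ℝ :=
  (2 : ℝ) ^ (1 / 2 + 1 / α) * Real.Gamma (1 / α) / (Real.sqrt Real.pi * α)

/-- `Ψ(x) = C₀(α) / (σ(x) √x)`. -/
def Psi (α : ℝ) (σ : ℝ → ℝ) (x : ℝ) : ℝ := C₀ α / (σ x * Real.sqrt x)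

/-- `∫_1^y x f'(x) / f(x) dx`. Only the derivative of `f` at points `x > 1` enters. -/
def logDerivIntegral (f : ℝ → ℝ) (y : ℝ) : ℝ := ∫ x in (1 : ℝ)..y, x * deriv f x / f x

/-- `H(y) = ∫_1^y x φ'(x) / φ(x) dx`. -/
def H (α : ℝ) (σ : ℝ → ℝ) (y : ℝ) : ℝ := logDerivIntegral (phi α σ) y

/-- `K(y) = ∫_1^y x Ψ'(x) / Ψ(x) dx`. -/
def K (α : ℝ) (σ : ℝ → ℝ) (y : ℝ) : ℝ := logDerivIntegral (Psi α σ) y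

/-- `μ` has the characteristic function `exp (-½ ∑_i |y_i|^α λ_i)`. -/
def HasStableCharFun [MeasurableSpace EllTwo] (μ : Measure EllTwo) (α : ℝ) (lam : ℕ → ℝ) : Prop :=
  ∀ y : EllTwo, charFun μ y = ((Real.exp (-(1 / 2) * ∑' i : ℕ, |y i| ^ α * lam i) : ℝ) : ℂ)

end StableSmallBall

end

/-!
Write `f = -log σ`, which is increasing and differentiable on `[1, ∞)`, and let `p = p_α(0)`.

*Bounded density.* The first `n` coordinates under `μ` have an integrable characteristic function,
so by Fourier inversion their joint density is at most the integral of that function,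
`∏ p / λ_i ^ (1/α) ≤ ∏ p / σ(i)` (`measureReal_le_of_integrable_charFun`,
`measureReal_le_of_projFirst`). Both `D_ε` and `S_ε` project into a compact set of `ℝⁿ`, a cube and
a Euclidean ball of known volume. For the cube this reads
`log μ(D_ε) ≤ ∑_{i ≤ n} log (ε φ(i))`. For the ball, `C₀ = √(2π) p`, and a form of Stirling's
inequality, `π n (n/e)ⁿ ≤ 2ⁿ Γ(n/2+1)²`, replaces the factor `1 / Γ(n/2+1)` at the cost of
an absolute constant.

*Sum against integral.* Since `f` is increasing, `∑_{i ≤ n} f(i) ≤ ∫₁ⁿ f + f(n)`; if `f` is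
concave, the trapezoidal rule underestimates the integral and gives
`∑_{i ≤ n} f(i) ≤ ∫₁ⁿ f + (f(1) + f(n)) / 2`. Integration by parts evaluates
`∫₁ⁿ f = n f(n) - f(1) - ∫₁ⁿ x f'(x) dx`, and the last integral is `H(n)`, respectively
`K(n) + (n - 1) / 2` (`H_eq`, `K_eq`).

*Conclusion.* With `n = ν(ε)` the terms proportional to `n` combine to `n log (ε φ(n)) ≤ 0`, and the
remaining `f(n)` is bounded by `-log ε` up to a constant, again because `ε φ(n) ≤ 1`. With
`n = η(ε)` the same happens with `Ψ` in place of `φ`; there the logarithm of `n` left over from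
Stirling's inequality and from `Ψ(n)` produces the exponent `-¼ log (ε² n)`. The constants involve
only `p`, `C₀` and `-f(1) = log σ(1) ≤ log (λ₁ ^ (1/α))`.
-/

namespace StableSmallBall

/-! ### A Stirling-type inequality for the Gamma function -/

/-- A sharp Stirling-type lower bound for `Γ` at half-integers. The duplication formula gives the
product `Γ((n+1)/2) Γ(n/2+1)`, and log-convexity of `Γ` bounds the first factor by the second. -/
theorem pi_mul_pow_le_two_pow_mul_Gamma_sq {n : ℕ} (hn : 1 ≤ n) :
    Real.pi * n * (n / Real.exp 1) ^ n ≤ 2 ^ n * Real.Gamma (n / 2 + 1) ^ 2 := by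
  have hn0 : (0 : ℝ) < n := by exact_mod_cast hn
  set a := Real.Gamma ((n : ℝ) / 2 + 1)
  set b := Real.Gamma (((n : ℝ) + 1) / 2)
  have ha : 0 < a := Real.Gamma_pos_of_pos (by positivity)
  have hb : 0 < b := Real.Gamma_pos_of_pos (by positivity)
  have hdup : b * a = n.factorial * 2 ^ (-(n : ℝ)) * √Real.pi := by
    have h := Real.Gamma_mul_Gamma_add_half (((n : ℝ) + 1) / 2)
    rw [show ((n : ℝ) + 1) / 2 + 1 / 2 = n / 2 + 1 by ring,
      show 2 * (((n : ℝ) + 1) / 2) = n + 1 by ring, Real.Gamma_nat_eq_factorial,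
      show 1 - ((n : ℝ) + 1) = -n by ring] at h
    exact h
  have hconv : b ^ 2 * (n / 2) ≤ a ^ 2 := by
    -- log-convexity at the midpoint of `n/2` and `n/2 + 1`
    have h := Real.Gamma_mul_add_mul_le_rpow_Gamma_mul_rpow_Gamma
      (s := (n : ℝ) / 2) (t := n / 2 + 1) (a := 1 / 2) (b := 1 / 2)
      (by positivity) (by positivity) (by norm_num) (by norm_num) (by norm_num)
    rw [show 1 / 2 * ((n : ℝ) / 2) + 1 / 2 * (n / 2 + 1) = (n + 1) / 2 by ring] at h
    have hg : a = n / 2 * Real.Gamma ((n : ℝ) / 2) := Real.Gamma_add_one (by positivity)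
    have hc : 0 < Real.Gamma ((n : ℝ) / 2) := Real.Gamma_pos_of_pos (by positivity)
    rw [← Real.mul_rpow hc.le ha.le, ← Real.sqrt_eq_rpow] at h
    have h2 : b ^ 2 ≤ Real.Gamma ((n : ℝ) / 2) * a := (Real.le_sqrt' hb).1 h
    calc b ^ 2 * (n / 2) ≤ Real.Gamma ((n : ℝ) / 2) * a * (n / 2) := by gcongr
      _ = a ^ 2 := by rw [pow_two]; nth_rewrite 2 [hg]; ring
  have hst := Stirling.le_factorial_stirling n
  have h2n : (2 : ℝ) ^ n * 2 ^ (-(n : ℝ)) = 1 := by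
    rw [Real.rpow_neg (by norm_num), Real.rpow_natCast, mul_inv_cancel₀ (by positivity)]
  have hab : b * √(n / 2) ≤ a := by
    refine (sq_le_sq₀ (by positivity) ha.le).1 ?_
    rw [mul_pow, Real.sq_sqrt (by positivity)]
    exact hconv
  calc Real.pi * n * (n / Real.exp 1) ^ n
      = √Real.pi * √(n / 2) * (√(2 * Real.pi * n) * (n / Real.exp 1) ^ n) := by
        rw [← mul_assoc, ← Real.sqrt_mul (by positivity), ← Real.sqrt_mul (by positivity),
          show Real.pi * ((n : ℝ) / 2) * (2 * Real.pi * n) = (Real.pi * n) ^ 2 by ring,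
          Real.sqrt_sq (by positivity)]
    _ ≤ √Real.pi * √(n / 2) * n.factorial := by gcongr
    _ = (2 ^ n * 2 ^ (-(n : ℝ))) * (√Real.pi * √(n / 2) * n.factorial) := by rw [h2n, one_mul]
    _ = 2 ^ n * (b * a * √(n / 2)) := by rw [hdup]; ring
    _ = 2 ^ n * (b * √(n / 2) * a) := by ring
    _ ≤ 2 ^ n * (a * a) := by gcongr
    _ = 2 ^ n * a ^ 2 := by rw [pow_two]

/-! ### Sums, integrals and integration by parts on `[1, n]` -/

theorem sum_le_integral_add_of_monotoneOn {f : ℝ → ℝ} (hf : MonotoneOn f (Set.Ici 1)) {n : ℕ}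
    (hn : 1 ≤ n) :
    ∑ i ∈ Finset.range n, f ((i : ℝ) + 1) ≤ (∫ x in (1 : ℝ)..n, f x) + f n := by
  obtain ⟨m, rfl⟩ := Nat.exists_eq_add_of_le' hn
  have h := MonotoneOn.sum_le_integral (x₀ := 1) (a := m) (hf.mono Set.Icc_subset_Ici_self)
  rw [Finset.sum_range_succ, Nat.cast_succ]
  simp only [add_comm (1 : ℝ)] at h
  linarith

/-- The trapezoidal rule underestimates the integral of a concave function. -/
theorem sum_le_integral_add_half_of_concaveOn {f : ℝ → ℝ} (hf : ConcaveOn ℝ (Set.Ici 1) f)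
    (hc : ContinuousOn f (Set.Ici 1)) {n : ℕ} (hn : 1 ≤ n) :
    ∑ i ∈ Finset.range n, f ((i : ℝ) + 1) ≤ (∫ x in (1 : ℝ)..n, f x) + (f 1 + f n) / 2 := by
  have hint : ∀ a b : ℝ, 1 ≤ a → 1 ≤ b → IntervalIntegrable f volume a b := fun a b ha hb =>
    (hc.mono fun x hx => le_trans (le_inf ha hb) hx.1).intervalIntegrable
  induction n, hn using Nat.le_induction with
  | base => norm_num
  | succ n hn ih =>
    have hn1 : (1 : ℝ) ≤ n := by exact_mod_cast hn
    -- on `[n, n+1]` the function lies above its chord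
    have hstep : (f n + f (n + 1)) / 2 ≤ ∫ x in (n : ℝ)..(n + 1), f x := by
      have hlin : ∫ x in (n : ℝ)..(n + 1), (f n + (x - n) * (f (n + 1) - f n))
          = (f n + f (n + 1)) / 2 := by
        rw [intervalIntegral.integral_add (by simp)
          (Continuous.intervalIntegrable (by fun_prop) _ _),
          intervalIntegral.integral_mul_const, intervalIntegral.integral_sub (by simp) (by simp)]
        simp
        ring
      rw [← hlin]
      refine intervalIntegral.integral_mono_on (by linarith)
        (Continuous.intervalIntegrable (by fun_prop) _ _) (hint _ _ hn1 (by linarith)) fun x hx => ?_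
      have h := hf.2 (Set.mem_Ici.2 hn1) (show (n : ℝ) + 1 ∈ Set.Ici 1 by simp)
        (show 0 ≤ 1 - (x - n) by linarith [hx.2]) (show 0 ≤ x - n by linarith [hx.1]) (by ring)
      simp only [smul_eq_mul] at h
      rw [show (1 - (x - (n : ℝ))) * n + (x - n) * (n + 1) = x by ring] at h
      linarith
    rw [Finset.sum_range_succ, Nat.cast_succ,
      ← intervalIntegral.integral_add_adjacent_intervals (hint 1 n le_rfl hn1)
        (hint n (n + 1) hn1 (by linarith))]
    linarith

/-- Integration by parts against `x`. Monotonicity makes the derivative nonnegative, hence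
integrable, although it need not be continuous; at the left endpoint `1` only one-sided
differentiability is available. -/
theorem integral_mul_deriv_of_monotoneOn {f : ℝ → ℝ} (hm : MonotoneOn f (Set.Ici 1))
    (hd : DifferentiableOn ℝ f (Set.Ici 1)) {y : ℝ} (hy : 1 ≤ y) :
    IntervalIntegrable (fun x => x * deriv f x) volume 1 y ∧
      ∫ x in (1 : ℝ)..y, x * deriv f x = y * f y - f 1 - ∫ x in (1 : ℝ)..y, f x := by
  have hc : ContinuousOn f (Set.Icc 1 y) := hd.continuousOn.mono Set.Icc_subset_Ici_self
  have hder : ∀ x ∈ Set.Ioo 1 y, HasDerivAt f (deriv f x) x := fun x hx =>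
    (hd.differentiableAt (Ici_mem_nhds hx.1)).hasDerivAt
  have hpos : ∀ x ∈ Set.Ioo 1 y, 0 ≤ deriv f x := fun x hx => by
    rw [← derivWithin_of_mem_nhds (Ici_mem_nhds hx.1)]
    exact hm.derivWithin_nonneg
  have hint : IntervalIntegrable (deriv f) volume 1 y :=
    (intervalIntegrable_iff_integrableOn_Ioc_of_le hy).2
      (intervalIntegral.integrableOn_deriv_of_nonneg hc hder hpos)
  refine ⟨hint.continuousOn_mul continuousOn_id, ?_⟩
  have h := intervalIntegral.integral_mul_deriv_eq_deriv_mul_of_hasDerivAt (a := 1) (b := y)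
    (u := fun x => x) (u' := fun _ => 1) (v := f) (v' := deriv f) continuousOn_id
    (by rwa [Set.uIcc_of_le hy]) (fun x _ => hasDerivAt_id x)
    (by rwa [min_eq_left hy, max_eq_right hy]) (by simp) hint
  simpa using h

section FourierBound

/-! ### Measures with integrable characteristic function -/

open FourierTransform SchwartzMap
open scoped Manifold ContDiff

variable {V : Type*} [NormedAddCommGroup V] [InnerProductSpace ℝ V] [FiniteDimensional ℝ V]
  [MeasurableSpace V] [BorelSpace V]

/-- Fourier inversion and Fubini give `∫ g dP = ∫ (𝓕⁻ g)(ξ) P̂(-2πξ) dξ` for Schwartz `g`, and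
`‖𝓕⁻ g‖_∞ ≤ ‖g‖₁`. The scaling `-2π` translates between the conventions of `charFun` and `𝓕`. -/
theorem norm_integral_schwartz_le (P : Measure V) [IsFiniteMeasure P]
    (hP : Integrable fun ξ : V => charFun P (-(2 * Real.pi) • ξ)) (g : 𝓢(V, ℂ)) :
    ‖∫ x, g x ∂P‖ ≤ (∫ ξ : V, ‖charFun P (-(2 * Real.pi) • ξ)‖) * ∫ x, ‖g x‖ := by
  have hflip := VectorFourier.integral_fourierIntegral_smul_eq_flip (μ := P) (ν := volume)
    (e := Real.fourierChar) (L := innerₗ V) (f := fun _ => (1 : ℂ)) (g := (𝓕⁻ g : 𝓢(V, ℂ)))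
    Real.continuous_fourierChar continuous_inner (integrable_const _)
    (𝓕⁻ g : 𝓢(V, ℂ)).integrable
  have h1 : ∀ ξ : V, VectorFourier.fourierIntegral Real.fourierChar P (innerₗ V)
      (fun _ => (1 : ℂ)) ξ = charFun P (-(2 * Real.pi) • ξ) := fun ξ => by
    rw [charFun_eq_fourierIntegral', smul_smul, show -(2 * Real.pi)⁻¹ * -(2 * Real.pi) = 1 by
      field_simp, one_smul]
    rfl
  have h2 : ∀ x : V, VectorFourier.fourierIntegral Real.fourierChar volume (innerₗ V).flip
      (𝓕⁻ g : 𝓢(V, ℂ)) x = g x := fun x => by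
    have : (𝓕 (𝓕⁻ g : 𝓢(V, ℂ)) : 𝓢(V, ℂ)) x = g x := by rw [FourierTransform.fourier_fourierInv_eq]
    rw [← this, fourier_coe, flip_innerₗ]
    rfl
  have hinv : ∀ ξ : V, ‖(𝓕⁻ g : 𝓢(V, ℂ)) ξ‖ ≤ ∫ x, ‖g x‖ := fun ξ => by
    rw [fourierInv_coe, Real.fourierInv_eq]
    refine (norm_integral_le_integral_norm _).trans_eq ?_
    simp
  simp only [h1, h2, one_smul] at hflip
  rw [← hflip, ← integral_mul_const]
  refine norm_integral_le_of_norm_le (hP.norm.mul_const _) (.of_forall fun ξ => ?_)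
  rw [norm_smul]
  exact mul_le_mul_of_nonneg_left (hinv ξ) (norm_nonneg _)

/-- A finite measure with integrable characteristic function is dominated by Lebesgue measure
times the (suitably normalised) `L¹` norm of that function; stated for compact sets, whose
indicators are approximated from above by smooth functions of compact support. -/
theorem measureReal_le_of_integrable_charFun (P : Measure V) [IsFiniteMeasure P]
    (hP : Integrable fun ξ : V => charFun P (-(2 * Real.pi) • ξ)) {A : Set V} (hA : IsCompact A) :
    P.real A ≤ (∫ ξ : V, ‖charFun P (-(2 * Real.pi) • ξ)‖) * volume.real A := by
  set c := ∫ ξ : V, ‖charFun P (-(2 * Real.pi) • ξ)‖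
  have hc : 0 ≤ c := integral_nonneg fun _ => norm_nonneg _
  suffices h : ∀ δ > 0, P.real A ≤ c * (volume.real A + δ) by
    refine ge_of_tendsto (f := fun δ : ℝ => c * (volume.real A + δ)) (x := nhdsWithin 0 (Set.Ioi 0))
      ?_ (Filter.eventually_of_mem self_mem_nhdsWithin h)
    have : Continuous fun δ : ℝ => c * (volume.real A + δ) := by fun_prop
    simpa using (this.tendsto 0).mono_left nhdsWithin_le_nhds
  intro δ hδ
  obtain ⟨U, hAU, hUo, hU⟩ := A.exists_isOpen_lt_add (μ := (volume : Measure V))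
    hA.measure_lt_top.ne (ENNReal.ofReal_pos.2 hδ).ne'
  obtain ⟨W, hWo, hAW, hWU, hWc⟩ := exists_open_between_and_isCompact_closure hA hUo hAU
  obtain ⟨f, hf, hf01, hfW, hfA⟩ := exists_contMDiff_support_eq_eq_one_iff 𝓘(ℝ, V) (n := ⊤)
    hWo hA.isClosed hAW
  have hfs : HasCompactSupport f := by
    rw [HasCompactSupport, tsupport, hfW]; exact hWc
  have hgs : HasCompactSupport fun x => (f x : ℂ) := hfs.comp_left Complex.ofReal_zero
  have hgd : ContDiff ℝ ∞ fun x => (f x : ℂ) := Complex.ofRealCLM.contDiff.comp hf.contDiff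
  have hfi : ∀ (m : Measure V) [IsFiniteMeasureOnCompacts m], Integrable f m := fun m _ =>
    hf.continuous.integrable_of_hasCompactSupport hfs
  have key := norm_integral_schwartz_le P hP (hgs.toSchwartzMap hgd)
  have hf0 : ∀ x, 0 ≤ f x := fun x => (hf01 ⟨x, rfl⟩).1
  have hf1 : ∀ x, f x ≤ 1 := fun x => (hf01 ⟨x, rfl⟩).2
  have e : ∀ x, hgs.toSchwartzMap hgd x = (f x : ℂ) := fun x => rfl
  simp only [e, integral_complex_ofReal, Complex.norm_real, Real.norm_eq_abs,
    abs_of_nonneg (hf0 _)] at key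
  have hlow : P.real A ≤ ∫ x, f x ∂P := by
    rw [← integral_indicator_one hA.measurableSet]
    refine integral_mono ((integrable_const 1).indicator hA.measurableSet) (hfi P) fun x => ?_
    by_cases hx : x ∈ A
    · simp [hx, (hfA x).1 hx]
    · simp [hx, hf0 x]
  have hUtop : volume U ≠ ⊤ :=
    (hU.trans_le (le_of_lt (ENNReal.add_lt_top.2 ⟨hA.measure_lt_top, ENNReal.ofReal_lt_top⟩))).ne
  have hup : ∫ x, f x ≤ volume.real U := by
    rw [← integral_indicator_one hUo.measurableSet]
    refine integral_mono (hfi volume) ((integrable_indicator_iff hUo.measurableSet).2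
      (integrableOn_const hUtop)) fun x => ?_
    by_cases hx : x ∈ U
    · simp [hx, hf1 x]
    · have : f x = 0 := by
        rw [← Function.notMem_support, hfW]
        exact fun h => hx (hWU (subset_closure h))
      simp [hx, this]
  have hUle : volume.real U ≤ volume.real A + δ := by
    have := ENNReal.toReal_mono (ENNReal.add_ne_top.2 ⟨hA.measure_ne_top, ENNReal.ofReal_ne_top⟩)
      hU.le
    rwa [ENNReal.toReal_add hA.measure_ne_top ENNReal.ofReal_ne_top,
      ENNReal.toReal_ofReal hδ.le] at this
  exact hlow.trans ((le_abs_self _).trans (key.trans (mul_le_mul_of_nonneg_left (hup.trans hUle) hc)))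

end FourierBound

/-! ### The stable density at the origin -/

theorem integral_exp_neg_mul_abs_rpow {α b : ℝ} (hα : 0 < α) (hb : 0 < b) :
    ∫ t : ℝ, Real.exp (-(b * |t| ^ α)) = 2 * (b ^ (-(1 / α)) * Real.Gamma (1 / α + 1)) := by
  rw [integral_comp_abs (f := fun t => Real.exp (-(b * t ^ α)))]
  simp only [← neg_mul]
  rw [integral_exp_neg_mul_rpow hα hb, show -1 / α = -(1 / α) by ring]

theorem integrable_exp_neg_mul_abs_rpow {α b : ℝ} (hα : 0 < α) (hb : 0 < b) :
    Integrable fun t : ℝ => Real.exp (-(b * |t| ^ α)) := by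
  -- a nonzero Bochner integral certifies integrability
  refine Integrable.of_integral_ne_zero ?_
  rw [integral_exp_neg_mul_abs_rpow hα hb]
  have := Real.Gamma_pos_of_pos (show 0 < 1 / α + 1 by positivity)
  positivity

theorem stableDensity_zero {α : ℝ} (hα : 0 < α) :
    stableDensity α 0 = 2 ^ (1 / α) * Real.Gamma (1 / α + 1) / Real.pi := by
  have h := integral_exp_neg_mul_abs_rpow hα (show (0 : ℝ) < 1 / 2 by norm_num)
  simp only [stableDensity, mul_zero, Real.cos_zero, one_mul]
  simp only [div_mul_eq_mul_div, one_mul] at h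
  rw [h, one_div (2 : ℝ), Real.inv_rpow (by norm_num), Real.rpow_neg (by norm_num), inv_inv]
  field_simp

theorem stableDensity_zero_pos {α : ℝ} (hα : 0 < α) : 0 < stableDensity α 0 := by
  rw [stableDensity_zero hα]
  have := Real.Gamma_pos_of_pos (show 0 < 1 / α + 1 by positivity)
  have := Real.pi_pos
  positivity

theorem C₀_eq {α : ℝ} (hα : 0 < α) : C₀ α = √2 * √Real.pi * stableDensity α 0 := by
  rw [stableDensity_zero hα, C₀, Real.Gamma_add_one (by positivity), Real.rpow_add (by norm_num),
    ← Real.sqrt_eq_rpow]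
  have hp : Real.pi = √Real.pi * √Real.pi := (Real.mul_self_sqrt Real.pi_pos.le).symm
  have : 0 < √Real.pi := by positivity
  field_simp
  rw [Real.sq_sqrt Real.pi_pos.le]

/-- The one-dimensional normalising integral: the density at `0` of the stable law with scale
`l ^ (1 / α)`, in the normalisation of `𝓕`. -/
theorem integral_exp_neg_scaled {α l : ℝ} (hα : 0 < α) (hl : 0 < l) :
    ∫ t : ℝ, Real.exp (-(l * (2 * Real.pi) ^ α / 2 * |t| ^ α))
      = stableDensity α 0 / l ^ (1 / α) := by
  have hpi := Real.pi_pos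
  rw [integral_exp_neg_mul_abs_rpow hα (by positivity), stableDensity_zero hα, Real.rpow_neg
    (by positivity), Real.div_rpow (by positivity) (by norm_num), Real.mul_rpow hl.le (by positivity),
    ← Real.rpow_mul (by positivity), mul_one_div_cancel hα.ne', Real.rpow_one]
  field_simp

/-! ### Projections onto finitely many coordinates -/

/-- The projection of `ℓ₂` onto its first `n` coordinates, with values in the Euclidean space so that
Fourier analysis and the volume of Euclidean balls apply directly. -/
noncomputable def projFirst (n : ℕ) : EllTwo →L[ℝ] EuclideanSpace ℝ (Fin n) :=
  (PiLp.continuousLinearEquiv 2 ℝ (fun _ : Fin n => ℝ)).symm.toContinuousLinearMap.comp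
    (ContinuousLinearMap.pi fun i : Fin n => lp.evalCLM ℝ (fun _ : ℕ => ℝ) 2 (i : ℕ))

@[simp]
theorem projFirst_apply (n : ℕ) (x : EllTwo) (i : Fin n) : projFirst n x i = x i := rfl

/-- The adjoint of the projection extends a vector by zero. -/
theorem adjoint_projFirst_apply (n : ℕ) (t : EuclideanSpace ℝ (Fin n)) (j : ℕ) :
    (projFirst n).adjoint t j = if h : j < n then t ⟨j, h⟩ else 0 := by
  have h := lp.inner_single_left (𝕜 := ℝ) (G := fun _ : ℕ => ℝ) j (1 : ℝ) ((projFirst n).adjoint t)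
  rw [ContinuousLinearMap.adjoint_inner_right, PiLp.inner_apply] at h
  simp only [projFirst_apply, lp.single_apply] at h
  simp [Pi.single_apply] at h
  rw [← h]
  split_ifs with hj
  · rw [Finset.sum_eq_single ⟨j, hj⟩] <;> simp +contextual [Fin.ext_iff]
  · exact Finset.sum_eq_zero fun i _ => by simp [(i.2.trans_le (not_lt.1 hj)).ne]

theorem volumeReal_cube (n : ℕ) {ε : ℝ} (hε : 0 ≤ ε) :
    IsCompact {v : EuclideanSpace ℝ (Fin n) | ∀ i, |v i| ≤ ε} ∧
      volume.real {v : EuclideanSpace ℝ (Fin n) | ∀ i, |v i| ≤ ε} = (2 * ε) ^ n := by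
  have hset : {v : EuclideanSpace ℝ (Fin n) | ∀ i, |v i| ≤ ε}
      = (MeasurableEquiv.toLp 2 (Fin n → ℝ)).symm ⁻¹' Set.Icc (fun _ => -ε) (fun _ => ε) := by
    ext v
    simp [abs_le, Pi.le_def, forall_and]
  constructor
  · rw [hset]
    exact (PiLp.homeomorph 2 (fun _ : Fin n => ℝ)).isCompact_preimage.2 isCompact_Icc
  · rw [hset, Measure.real, (EuclideanSpace.volume_preserving_symm_measurableEquiv_toLp
      (Fin n)).measure_preimage measurableSet_Icc.nullMeasurableSet, Real.volume_Icc_pi_toReal]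
    · simp; ring
    · intro _; simp; linarith

theorem volumeReal_closedBall {n : ℕ} (hn : 1 ≤ n) {ε : ℝ} (hε : 0 ≤ ε) :
    volume.real (Metric.closedBall (0 : EuclideanSpace ℝ (Fin n)) ε)
      = ε ^ n * (√Real.pi ^ n / Real.Gamma (n / 2 + 1)) := by
  have : Nonempty (Fin n) := ⟨⟨0, hn⟩⟩
  have hg := Real.Gamma_pos_of_pos (show (0 : ℝ) < n / 2 + 1 by positivity)
  rw [Measure.real, EuclideanSpace.volume_closedBall, ENNReal.toReal_mul, ENNReal.toReal_pow,
    ENNReal.toReal_ofReal hε, Fintype.card_fin, ENNReal.toReal_ofReal (by positivity)]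

theorem supBall_subset (n : ℕ) (ε : ℝ) :
    supBall ε ⊆ projFirst n ⁻¹' {v | ∀ i, |v i| ≤ ε} := by
  intro x hx i
  have hb : BddAbove (Set.range fun i : ℕ => |x i|) :=
    ⟨‖x‖, by rintro _ ⟨j, rfl⟩; exact lp.norm_apply_le_norm (by norm_num) x j⟩
  exact (le_ciSup hb (i : ℕ)).trans hx

theorem normBall_subset (n : ℕ) (ε : ℝ) :
    normBall ε ⊆ projFirst n ⁻¹' Metric.closedBall 0 ε := by
  intro x hx
  have hx' : ‖x‖ ≤ ε := hx
  rw [Set.mem_preimage, mem_closedBall_zero_iff]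
  refine le_trans ?_ hx'
  refine (sq_le_sq₀ (norm_nonneg _) (norm_nonneg _)).1 ?_
  rw [EuclideanSpace.norm_sq_eq]
  have h := lp.sum_rpow_le_norm_rpow (p := 2) (by norm_num) x (Finset.range n)
  rw [← Fin.sum_univ_eq_sum_range (fun i => ‖x i‖ ^ (2 : ENNReal).toReal)] at h
  simpa using h

section

variable [MeasurableSpace EllTwo] [BorelSpace EllTwo]

theorem charFun_map_projFirst {μ : Measure EllTwo} {α : ℝ} {lam : ℕ → ℝ} (hα : 0 < α)
    (hμ : HasStableCharFun μ α lam) (n : ℕ) (t : EuclideanSpace ℝ (Fin n)) :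
    charFun (μ.map (projFirst n)) t
      = ((Real.exp (-(1 / 2) * ∑ i : Fin n, |t i| ^ α * lam i) : ℝ) : ℂ) := by
  have h1 : charFun (μ.map (projFirst n)) t = charFun μ ((projFirst n).adjoint t) := by
    rw [charFun_apply, charFun_apply, integral_map (projFirst n).continuous.aemeasurable
      (Continuous.aestronglyMeasurable (by fun_prop))]
    simp only [ContinuousLinearMap.adjoint_inner_right]
  rw [h1, hμ, tsum_eq_sum (s := Finset.range n), ← Fin.sum_univ_eq_sum_range
    (fun i => |(projFirst n).adjoint t i| ^ α * lam i)]
  · simp [adjoint_projFirst_apply]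
  · intro j hj
    rw [adjoint_projFirst_apply, dif_neg (by simpa using hj), abs_zero,
      Real.zero_rpow hα.ne', zero_mul]

/-- The law of the first `n` coordinates has a density bounded by `∏ p_α(0) / λ_i ^ (1/α)`. -/
theorem measureReal_le_of_projFirst {μ : Measure EllTwo} [IsProbabilityMeasure μ] {α : ℝ}
    {lam : ℕ → ℝ} (hα : 0 < α) (hμ : HasStableCharFun μ α lam) (n : ℕ)
    (hlam : ∀ i : Fin n, 0 < lam i) {A : Set EllTwo} {B : Set (EuclideanSpace ℝ (Fin n))}
    (hB : IsCompact B) (hAB : A ⊆ projFirst n ⁻¹' B) :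
    μ.real A ≤ (∏ i : Fin n, stableDensity α 0 / lam i ^ (1 / α)) * volume.real B := by
  have hpi := Real.pi_pos
  have hm : Measurable (projFirst n) := (projFirst n).continuous.measurable
  set b : Fin n → ℝ := fun i => lam i * (2 * Real.pi) ^ α / 2
  have hb : ∀ i, 0 < b i := fun i => by have := hlam i; positivity
  have hcf : ∀ ξ : EuclideanSpace ℝ (Fin n), charFun (μ.map (projFirst n)) (-(2 * Real.pi) • ξ)
      = ((∏ i, Real.exp (-(b i * |ξ i| ^ α)) : ℝ) : ℂ) := fun ξ => by
    rw [charFun_map_projFirst hα hμ, ← Real.exp_sum, Finset.mul_sum]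
    refine congrArg _ (congrArg _ (Finset.sum_congr rfl fun i _ => ?_))
    rw [PiLp.smul_apply, smul_eq_mul, abs_mul, abs_neg, abs_of_pos (by positivity : 0 < 2 * Real.pi),
      Real.mul_rpow (by positivity) (abs_nonneg _)]
    ring
  have hint : Integrable fun v : Fin n → ℝ => ∏ i, Real.exp (-(b i * |v i| ^ α)) :=
    Integrable.fintype_prod (f := fun i (v : ℝ) => Real.exp (-(b i * |v| ^ α)))
      fun i => integrable_exp_neg_mul_abs_rpow hα (hb i)
  have hint' : Integrable fun ξ : EuclideanSpace ℝ (Fin n) => ∏ i, Real.exp (-(b i * |ξ i| ^ α)) :=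
    ((EuclideanSpace.volume_preserving_symm_measurableEquiv_toLp (Fin n)).integrable_comp_emb
      (MeasurableEquiv.measurableEmbedding _)).2 hint
  have hval : ∫ ξ : EuclideanSpace ℝ (Fin n), ∏ i, Real.exp (-(b i * |ξ i| ^ α))
      = ∏ i : Fin n, stableDensity α 0 / lam i ^ (1 / α) := by
    rw [← (EuclideanSpace.volume_preserving_symm_measurableEquiv_toLp (Fin n)).symm.integral_comp
      (MeasurableEquiv.measurableEmbedding _)]
    refine (integral_fintype_prod_volume_eq_prod
      (fun i (v : ℝ) => Real.exp (-(b i * |v| ^ α)))).trans ?_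
    exact Finset.prod_congr rfl fun i _ => integral_exp_neg_scaled hα (hlam i)
  have key := measureReal_le_of_integrable_charFun (μ.map (projFirst n))
    (by simp only [hcf]; exact hint'.ofReal) hB
  have hnorm : ∀ ξ : EuclideanSpace ℝ (Fin n), ‖charFun (μ.map (projFirst n)) (-(2 * Real.pi) • ξ)‖
      = ∏ i, Real.exp (-(b i * |ξ i| ^ α)) := fun ξ => by
    rw [hcf, Complex.norm_real, Real.norm_of_nonneg (by positivity)]
  simp only [hnorm, hval] at key
  rw [map_measureReal_apply hm hB.measurableSet] at key
  exact (measureReal_mono hAB).trans key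

end

/-! ### The functions `H` and `K` -/

section Regularity

variable {σ : ℝ → ℝ}

theorem differentiableOn_neg_log (hd : DifferentiableOn ℝ σ (Set.Ici 1))
    (hpos : ∀ x, 1 ≤ x → 0 < σ x) : DifferentiableOn ℝ (fun x => -Real.log (σ x)) (Set.Ici 1) :=
  (hd.log fun x hx => (hpos x hx).ne').neg

theorem monotoneOn_neg_log (ha : AntitoneOn σ (Set.Ici 1))
    (hpos : ∀ x, 1 ≤ x → 0 < σ x) : MonotoneOn (fun x => -Real.log (σ x)) (Set.Ici 1) :=
  fun _ hx _ hy hxy => neg_le_neg (Real.log_le_log (hpos _ hy) (ha hx hy hxy))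

theorem deriv_neg_log (hd : DifferentiableOn ℝ σ (Set.Ici 1)) (hpos : ∀ x, 1 ≤ x → 0 < σ x)
    {x : ℝ} (hx : 1 < x) : deriv (fun x => -Real.log (σ x)) x = -(deriv σ x / σ x) :=
  (((hd.differentiableAt (Ici_mem_nhds hx)).hasDerivAt.log (hpos x hx.le).ne').neg).deriv

/-- On `(1, y)` the integrand of `H` is `x (-log σ)'(x)`, since `φ` is a constant multiple of
`1 / σ`. -/
theorem H_eq {α : ℝ} (hα : 0 < α) (hd : DifferentiableOn ℝ σ (Set.Ici 1))
    (ha : AntitoneOn σ (Set.Ici 1)) (hpos : ∀ x, 1 ≤ x → 0 < σ x) {y : ℝ} (hy : 1 ≤ y) :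
    H α σ y = y * -Real.log (σ y) + Real.log (σ 1) - ∫ x in (1 : ℝ)..y, -Real.log (σ x) := by
  have h := (integral_mul_deriv_of_monotoneOn (monotoneOn_neg_log ha hpos)
    (differentiableOn_neg_log hd hpos) hy).2
  rw [sub_neg_eq_add] at h
  rw [← h, H, logDerivIntegral]
  refine intervalIntegral.integral_congr_ae (.of_forall fun x hx => ?_)
  rw [Set.uIoc_of_le hy] at hx
  have hs := hpos x hx.1.le
  have hp := stableDensity_zero_pos hα
  have hder := (hd.differentiableAt (Ici_mem_nhds hx.1)).hasDerivAt
  have hphi : deriv (phi α σ) x = _ :=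
    ((hasDerivAt_const x (2 * stableDensity α 0)).div hder hs.ne').deriv
  rw [deriv_neg_log hd hpos hx.1, hphi, phi]
  field_simp
  ring

/-- The factor `1 / √x` in `Ψ` contributes `-1/2` to the integrand `x Ψ'(x) / Ψ(x)`. -/
theorem K_eq {α : ℝ} (hα : 0 < α) (hd : DifferentiableOn ℝ σ (Set.Ici 1))
    (ha : AntitoneOn σ (Set.Ici 1)) (hpos : ∀ x, 1 ≤ x → 0 < σ x) {y : ℝ} (hy : 1 ≤ y) :
    K α σ y = y * -Real.log (σ y) + Real.log (σ 1) - (∫ x in (1 : ℝ)..y, -Real.log (σ x))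
      - (y - 1) / 2 := by
  obtain ⟨hi, h⟩ := integral_mul_deriv_of_monotoneOn (monotoneOn_neg_log ha hpos)
    (differentiableOn_neg_log hd hpos) hy
  rw [sub_neg_eq_add] at h
  have hconst : ∫ _ in (1 : ℝ)..y, (1 / 2 : ℝ) = (y - 1) / 2 := by
    rw [intervalIntegral.integral_const, smul_eq_mul]; ring
  rw [← h, ← hconst, ← intervalIntegral.integral_sub hi (by simp), K, logDerivIntegral]
  refine intervalIntegral.integral_congr_ae (.of_forall fun x hx => ?_)
  rw [Set.uIoc_of_le hy] at hx
  have hs := hpos x hx.1.le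
  have hx0 : 0 < x := by linarith [hx.1]
  have hC : 0 < C₀ α := by
    have := stableDensity_zero_pos hα
    have := Real.pi_pos
    rw [C₀_eq hα]; positivity
  have hder := (hd.differentiableAt (Ici_mem_nhds hx.1)).hasDerivAt
  have hsq : 0 < √x := Real.sqrt_pos.2 hx0
  have hPsi : deriv (Psi α σ) x = _ :=
    ((hasDerivAt_const x (C₀ α)).div (hder.mul (Real.hasDerivAt_sqrt hx0.ne'))
      (mul_pos hs hsq).ne').deriv
  rw [deriv_neg_log hd hpos hx.1, hPsi, Psi]
  simp only [Pi.mul_apply]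
  have hx2 : x = √x ^ 2 := (Real.sq_sqrt hx0.le).symm
  -- clear the square root: everything becomes rational in `r = √x`
  generalize √x = r at *
  subst hx2
  field_simp
  ring

end Regularity

/-! ### Exponential bounds for the measure of the balls -/

theorem prod_density_le {α : ℝ} (hα : 0 < α) {lam : ℕ → ℝ} {σ : ℝ → ℝ}
    (hpos : ∀ x, 1 ≤ x → 0 < σ x) (hle : ∀ i : ℕ, σ ((i : ℝ) + 1) ≤ lam i ^ (1 / α)) (n : ℕ) :
    ∏ i : Fin n, stableDensity α 0 / lam i ^ (1 / α)
      ≤ Real.exp (n * Real.log (stableDensity α 0)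
        + ∑ i ∈ Finset.range n, -Real.log (σ ((i : ℝ) + 1))) := by
  have hp := stableDensity_zero_pos hα
  have hσ : ∀ i : ℕ, 0 < σ ((i : ℝ) + 1) := fun i => hpos _ (by linarith [i.cast_nonneg (α := ℝ)])
  rw [Fin.prod_univ_eq_prod_range (fun i => stableDensity α 0 / lam i ^ (1 / α)) n, Real.exp_add,
    Real.exp_nat_mul, Real.exp_log hp, Real.exp_sum, ← Finset.card_range n, ← Finset.prod_const,
    Finset.card_range, ← Finset.prod_mul_distrib]
  refine Finset.prod_le_prod (fun i _ => (div_pos hp ((hσ i).trans_le (hle i))).le) fun i _ => ?_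
  rw [Real.exp_neg, Real.exp_log (hσ i), ← div_eq_mul_inv]
  exact div_le_div_of_nonneg_left hp.le (hσ i) (hle i)

section Bounds

variable [MeasurableSpace EllTwo] [BorelSpace EllTwo] {μ : Measure EllTwo} [IsProbabilityMeasure μ]
  {α : ℝ} {lam : ℕ → ℝ} {σ : ℝ → ℝ} {ε : ℝ}

theorem measureReal_supBall_le (hα : 0 < α) (hμ : HasStableCharFun μ α lam)
    (hlam : ∀ i, 0 < lam i) (hpos : ∀ x, 1 ≤ x → 0 < σ x)
    (hle : ∀ i : ℕ, σ ((i : ℝ) + 1) ≤ lam i ^ (1 / α)) (hε : 0 < ε) (n : ℕ) :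
    μ.real (supBall ε) ≤ Real.exp (n * (Real.log ε + Real.log (2 * stableDensity α 0))
      + ∑ i ∈ Finset.range n, -Real.log (σ ((i : ℝ) + 1))) := by
  have hp := stableDensity_zero_pos hα
  obtain ⟨hK, hvol⟩ := volumeReal_cube n hε.le
  refine (measureReal_le_of_projFirst hα hμ n (fun i => hlam i) hK (supBall_subset n ε)).trans ?_
  rw [hvol, ← Real.exp_log (show 0 < 2 * ε by positivity), ← Real.exp_nat_mul]
  refine (mul_le_mul_of_nonneg_right (prod_density_le hα hpos hle n) (Real.exp_nonneg _)).trans ?_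
  rw [← Real.exp_add, Real.log_mul two_ne_zero hε.ne', Real.log_mul two_ne_zero hp.ne']
  exact (congrArg Real.exp (by ring)).le

theorem measureReal_normBall_le (hα : 0 < α) (hμ : HasStableCharFun μ α lam)
    (hlam : ∀ i, 0 < lam i) (hpos : ∀ x, 1 ≤ x → 0 < σ x)
    (hle : ∀ i : ℕ, σ ((i : ℝ) + 1) ≤ lam i ^ (1 / α)) (hε : 0 < ε) {n : ℕ} (hn : 1 ≤ n) :
    μ.real (normBall ε) ≤ Real.exp (n * (Real.log ε + Real.log (C₀ α))
      + ∑ i ∈ Finset.range n, -Real.log (σ ((i : ℝ) + 1))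
      - (Real.log Real.pi + Real.log n + n * (Real.log n - 1)) / 2) := by
  have hp := stableDensity_zero_pos hα
  have hpi := Real.pi_pos
  have hn0 : (0 : ℝ) < n := by exact_mod_cast hn
  have hg := Real.Gamma_pos_of_pos (show (0 : ℝ) < n / 2 + 1 by positivity)
  have hlogG := Real.log_le_log (by positivity) (pi_mul_pow_le_two_pow_mul_Gamma_sq hn)
  rw [Real.log_mul (by positivity) (by positivity), Real.log_mul hpi.ne' hn0.ne', Real.log_pow,
    Real.log_div hn0.ne' (Real.exp_ne_zero 1), Real.log_exp, Real.log_mul (by positivity)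
    (by positivity), Real.log_pow, Real.log_pow] at hlogG
  push_cast at hlogG
  have hlogC : Real.log (C₀ α)
      = Real.log 2 / 2 + Real.log Real.pi / 2 + Real.log (stableDensity α 0) := by
    rw [C₀_eq hα, Real.log_mul (by positivity) hp.ne', Real.log_mul (by positivity) (by positivity),
      Real.log_sqrt (by norm_num), Real.log_sqrt hpi.le]
  have hvol : volume.real (Metric.closedBall (0 : EuclideanSpace ℝ (Fin n)) ε)
      = Real.exp (n * Real.log ε + (n * (Real.log Real.pi / 2)
        - Real.log (Real.Gamma (n / 2 + 1)))) := by
    rw [volumeReal_closedBall hn hε.le, Real.exp_add, Real.exp_sub, Real.exp_nat_mul,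
      Real.exp_nat_mul, Real.exp_log hε, Real.exp_log hg, ← Real.log_sqrt hpi.le,
      Real.exp_log (by positivity)]
  refine (measureReal_le_of_projFirst hα hμ n (fun i => hlam i) (isCompact_closedBall _ _)
    (normBall_subset n ε)).trans ?_
  rw [hvol]
  refine (mul_le_mul_of_nonneg_right (prod_density_le hα hpos hle n) (Real.exp_nonneg _)).trans ?_
  rw [← Real.exp_add]
  refine Real.exp_le_exp.2 ?_
  rw [hlogC]
  linarith

end Bounds

end StableSmallBall

open StableSmallBall

/-! ### Small ball estimates -/

/-- `lam i` is `λ_{i+1}`, so `lam 0` is `λ₁`. The constant `C` depends on `α` and `λ₁` only. -/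
theorem proposition1
    [MeasurableSpace StableSmallBall.EllTwo] [BorelSpace StableSmallBall.EllTwo]
    (α : ℝ) (hα0 : 0 < α) (hα2 : α ≤ 2) (lam₁ : ℝ) :
    ∃ C : ℝ, 0 < C ∧
      ∀ (lam : ℕ → ℝ), lam 0 = lam₁ → Antitone lam → (∀ i, 0 ≤ lam i) → Summable lam →
      ∀ (μ : MeasureTheory.Measure StableSmallBall.EllTwo),
        MeasureTheory.IsProbabilityMeasure μ →
        StableSmallBall.HasStableCharFun μ α lam →
      ∀ (σ : ℝ → ℝ), DifferentiableOn ℝ σ (Set.Ici 1) → AntitoneOn σ (Set.Ici 1) →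
        (∀ x, 1 ≤ x → 0 < σ x) → (∀ i : ℕ, σ ((i : ℝ) + 1) ≤ lam i ^ (1 / α)) →
      ∀ (ν : ℝ → ℕ+),
        (∀ ε : ℝ, 0 < ε → ε < (StableSmallBall.phi α σ 1)⁻¹ →
          ε * StableSmallBall.phi α σ (ν ε : ℕ) ≤ 1) →
      ∀ (η : ℝ → ℕ+),
        (∀ ε : ℝ, 0 < ε → ε < (StableSmallBall.Psi α σ 1)⁻¹ →
          ε * StableSmallBall.Psi α σ (η ε : ℕ) ≤ 1) →
      ∀ ε : ℝ, 0 < ε →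
        ε < (max (StableSmallBall.phi α σ 1) (StableSmallBall.Psi α σ 1))⁻¹ →
        μ.real (StableSmallBall.supBall ε) ≤
            C * Real.exp (-StableSmallBall.H α σ (ν ε : ℕ) - Real.log ε) ∧
        μ.real (StableSmallBall.normBall ε) ≤
            C * Real.exp (-StableSmallBall.K α σ (η ε : ℕ) - Real.log ε) ∧
        (ConvexOn ℝ (Set.Ici 1) (fun x => Real.log (σ x)) →
          μ.real (StableSmallBall.supBall ε) ≤
              C * Real.exp (-StableSmallBall.H α σ (ν ε : ℕ) - 1 / 2 * Real.log ε) ∧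
          μ.real (StableSmallBall.normBall ε) ≤
              C * Real.exp (-StableSmallBall.K α σ (η ε : ℕ)
                - 1 / 4 * Real.log (ε ^ 2 * ((η ε : ℕ) : ℝ)))) := by

  have hp := stableDensity_zero_pos hα0
  have hC : 0 < C₀ α := by
    have := Real.pi_pos
    rw [C₀_eq hα0]; positivity
  set p := Real.log (2 * stableDensity α 0)
  set c := Real.log (C₀ α)
  set l := Real.log (lam₁ ^ (1 / α))
  refine ⟨Real.exp (|p| + |c| + |l| + 1), Real.exp_pos _, ?_⟩
  intro lam hlam0 _ hlam _ μ _ hμ σ hd ha hpos hle ν hν η hη ε hε hεmax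
  -- positivity of `σ` forces every `λ_i` to be nonzero
  have hlam' : ∀ i, 0 < lam i := fun i => (hlam i).lt_of_ne' fun h => by
    have h1 := hle i
    rw [h, Real.zero_rpow (by positivity)] at h1
    exact h1.not_gt (hpos _ (by linarith [i.cast_nonneg (α := ℝ)]))
  have hσ1 : Real.log (σ 1) ≤ l := by
    have h := hle 0
    rw [hlam0, Nat.cast_zero, zero_add] at h
    exact Real.log_le_log (hpos 1 le_rfl) h
  have hphi1 : 0 < phi α σ 1 := div_pos (by positivity) (hpos 1 le_rfl)
  have hPsi1 : 0 < Psi α σ 1 := div_pos hC (mul_pos (hpos 1 le_rfl) (by simp))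
  have hεphi : ε < (phi α σ 1)⁻¹ :=
    hεmax.trans_le (inv_anti₀ hphi1 (le_max_left _ _))
  have hεPsi : ε < (Psi α σ 1)⁻¹ :=
    hεmax.trans_le (inv_anti₀ hPsi1 (le_max_right _ _))
  have hp_abs := abs_le.1 (le_refl |p|)
  have hc_abs := abs_le.1 (le_refl |c|)
  have hl_abs := abs_le.1 (le_refl |l|)
  have hπ : 0 ≤ Real.log Real.pi := Real.log_nonneg (by linarith [Real.pi_gt_three])
  have hν1 : 1 ≤ (ν ε : ℕ) := (ν ε).pos
  have hνε := hν ε hε hεphi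
  generalize (ν ε : ℕ) = n at hν1 hνε ⊢
  have hη1 : 1 ≤ (η ε : ℕ) := (η ε).pos
  have hηε := hη ε hε hεPsi
  generalize (η ε : ℕ) = m at hη1 hηε ⊢
  have hn : (1 : ℝ) ≤ n := by exact_mod_cast hν1
  have hm : (1 : ℝ) ≤ m := by exact_mod_cast hη1
  have hm0 : (0 : ℝ) < m := by linarith
  -- the logarithms of `ε φ(n) ≤ 1` and `ε Ψ(m) ≤ 1`
  have hlogn : Real.log ε + p - Real.log (σ n) ≤ 0 := by
    have h := Real.log_nonpos (by have := hpos n hn; rw [phi]; positivity) hνε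
    rw [phi, Real.log_mul hε.ne' (by have := hpos n hn; positivity),
      Real.log_div (by positivity) (hpos n hn).ne'] at h
    linarith
  have hlogm : Real.log ε + c - Real.log (σ m) - Real.log m / 2 ≤ 0 := by
    have hs := hpos m hm
    have h := Real.log_nonpos (by rw [Psi]; positivity) hηε
    rw [Psi, Real.log_mul hε.ne' (by positivity), Real.log_div hC.ne' (by positivity),
      Real.log_mul hs.ne' (by positivity), Real.log_sqrt hm0.le] at h
    linarith
  have hsup := measureReal_supBall_le hα0 hμ hlam' hpos hle hε n
  have hball := measureReal_normBall_le hα0 hμ hlam' hpos hle hε hη1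
  have hH := H_eq hα0 hd ha hpos hn
  have hK := K_eq hα0 hd ha hpos hm
  have hmon := monotoneOn_neg_log ha hpos
  have hprodn : (n : ℝ) * (Real.log ε + p - Real.log (σ n)) ≤ 0 :=
    mul_nonpos_of_nonneg_of_nonpos (by linarith) hlogn
  have hprodm : (m : ℝ) * (Real.log ε + c - Real.log (σ m) - Real.log m / 2) ≤ 0 :=
    mul_nonpos_of_nonneg_of_nonpos (by linarith) hlogm
  refine ⟨?_, ?_, fun hconv => ?_⟩
  · have hsum := sum_le_integral_add_of_monotoneOn hmon hν1
    refine hsup.trans ?_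
    rw [← Real.exp_add]
    refine Real.exp_le_exp.2 ?_
    linarith
  · have hsum := sum_le_integral_add_of_monotoneOn hmon hη1
    refine hball.trans ?_
    rw [← Real.exp_add]
    refine Real.exp_le_exp.2 ?_
    linarith
  have hconc : ConcaveOn ℝ (Set.Ici 1) fun x => -Real.log (σ x) := hconv.neg
  have hcont := (differentiableOn_neg_log hd hpos).continuousOn
  constructor
  · have hsum := sum_le_integral_add_half_of_concaveOn hconc hcont hν1
    refine hsup.trans ?_
    rw [← Real.exp_add]
    refine Real.exp_le_exp.2 ?_
    linarith
  · have hsum := sum_le_integral_add_half_of_concaveOn hconc hcont hη1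
    refine hball.trans ?_
    rw [← Real.exp_add, Real.log_mul (by positivity) hm0.ne', Real.log_pow]
    refine Real.exp_le_exp.2 ?_
    push_cast
    linarith
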